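/- Let $r\ge 1$ be real and let $[a,b]\subset\mathbb R$ be a compact interval, $a<b$. A function $f\colon[a,b]\to\mathbb R$ is called HK$_r$-integrable if there is a function $F\colon[a,b]\to\mathbb R$, $F\in L^r[a,b]$, such that for every $\varepsilon>0$ there is a positive function $\delta$ on $[a,b]$ with the following property: for every finite collection $\{([c_i,d_i],x_i)\}_{i=1}^q$ of pairwise non-overlapping nondegenerate intervals $[c_i,d_i]\subset[a,b]$ with tags $x_i\in[c_i,d_i]$ and $[c_i,d_i]\subset(x_i-\delta(x_i),x_i+\delta(x_i))$, \[\sum_{i=1}^{q}\left(\frac{1}{d_i-c_i}\int_{c_i}^{d_i}\lvert F(y)-F(x_i)-f(x_i)(y-x_i)\rvert^r\,dy\right)^{1/r}<\varepsilon .\] Such an $F$ normalized by $F(a)=0$ is called the indefinite HK$_r$-integral of $f$. A function $F\colon[a,b]\to\mathbb R$ is called an $[$ACG$]$-function if $[a,b]=\bigcup_{n=1}^\infty D_n$ with closed sets $D_n$ such that each restriction $F\restriction D_n$ is absolutely continuous, that is, for every $\varepsilon>0$ there is $\eta>0$ such that $\sum_i|F(d_i)-F(c_i)|<\varepsilon$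 for every finite collection of non-overlapping intervals $[c_i,d_i]$ with endpoints $c_i,d_i\in D_n$ and $\sum_i(d_i-c_i)<\eta$. Then every indefinite HK$_r$-integral (of an HK$_r$-integrable function on $[a,b]$) is an $[$ACG$]$-function. -/

import Mathlib

open MeasureTheory Set

/-- A division in `[a, b]`: a finite collection of pairs `([c i, d i], x i)`, `i < q`, where the
`[c i, d i]` are nondegenerate compact subintervals of `[a, b]`, pairwise without common inner
points, and every tag `x i` lies in `[c i, d i]`. -/
structure IsDivision (a b : ℝ) {q : ℕ} (c d x : Fin q → ℝ) : Prop where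
  lt : ∀ i, c i < d i
  subset : ∀ i, Icc (c i) (d i) ⊆ Icc a b
  tag_mem : ∀ i, x i ∈ Icc (c i) (d i)
  nonoverlapping : Pairwise fun i j => Disjoint (Ioo (c i) (d i)) (Ioo (c j) (d j))

/-- The division is `δ`-fine: `[c i, d i] ⊆ (x i - δ (x i), x i + δ (x i))` for every `i`. -/
def IsFine (δ : ℝ → ℝ) {q : ℕ} (c d x : Fin q → ℝ) : Prop :=
  ∀ i, Icc (c i) (d i) ⊆ Ioo (x i - δ (x i)) (x i + δ (x i))

/-- `F ∈ L^r[a, b]` witnesses that `f` is `HK_r`-integrable on `[a, b]`. Only the values of `f`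
and `F` on `[a, b]` matter. -/
def IsHKrPrimitive (r a b : ℝ) (f F : ℝ → ℝ) : Prop :=
  MemLp F (ENNReal.ofReal r) (volume.restrict (Icc a b)) ∧
    ∀ ε : ℝ, 0 < ε → ∃ δ : ℝ → ℝ, (∀ t ∈ Icc a b, 0 < δ t) ∧
      ∀ (q : ℕ) (c d x : Fin q → ℝ), IsDivision a b c d x → IsFine δ c d x →
        ∑ i, (1 / (d i - c i) *
          ∫ y in (c i)..(d i), |F y - F (x i) - f (x i) * (y - x i)| ^ r) ^ (1 / r) < ε

/-- `F` is the indefinite `HK_r`-integral of `f` on `[a, b]`, normalized by `F a = 0`. -/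
def IsIndefiniteHKr (r a b : ℝ) (f F : ℝ → ℝ) : Prop :=
  IsHKrPrimitive r a b f F ∧ F a = 0

/-- The restriction of `F` to the set `D` is absolutely continuous: the nonoverlapping intervals
tested are those with both endpoints in `D`. -/
def IsACOn (F : ℝ → ℝ) (D : Set ℝ) : Prop :=
  ∀ ε : ℝ, 0 < ε → ∃ η : ℝ, 0 < η ∧
    ∀ (q : ℕ) (c d : Fin q → ℝ), (∀ i, c i ∈ D ∧ d i ∈ D ∧ c i < d i) →
      (Pairwise fun i j => Disjoint (Ioo (c i) (d i)) (Ioo (c j) (d j))) →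
      ∑ i, (d i - c i) < η → ∑ i, |F (d i) - F (c i)| < ε

/-- `F` is an `[ACG]`-function on `[a, b]`: `[a, b]` is a countable union of closed sets on each
of which `F` is absolutely continuous. -/
def IsClosedACG (a b : ℝ) (F : ℝ → ℝ) : Prop :=
  ∃ D : ℕ → Set ℝ, (∀ n, IsClosed (D n)) ∧ (⋃ n, D n) = Icc a b ∧ ∀ n, IsACOn F (D n)

/-! By Jensen's inequality the condition for `r` implies the one for `r = 1`, so only sums of mean
deviations `meanDev` matter. Fix a gauge `δ` for `ε` and let `E` be a set where `h ≤ δ` and `|f| ≤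
m`. A short interval with both endpoints in `E` may be tagged at either end; comparing the two
affine approximations bounds the sum of `|F d - F c|` by `2 * ε + m * ∑ (d - c)`
(`ControlsMeanDev.sum_abs_sub_le`).

This bound passes to `closure E` because `F y → F x` as `y → x` along `E`
(`tendsto_nhdsWithin_gaugeLevel`). Otherwise, points `y` near `x` would have `F y` far from `F x`;
since the deviation tagged at `x` is small, the one tagged at `y` is large on the half of the
interval nearer `y`. Infinitely many such halves are disjoint and `δ`-fine, which contradicts the
bound `ε`.

So `F` is continuous on `closure E` and, on short closed pieces `D` of it, of bounded variation. For
absolute continuity on `D` a finer gauge is needed for every `θ`. Its levels exhaust `D` by closed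
sets `C n` on which the variation over short families is at most `θ`, and the finite variation
measure of `D \ C n` tends to zero (`isACOn_of_exhaustion`). The atoms of that measure at right ends
of gaps of `D` are harmless: only short gaps occur, and their total mass is small. -/

open Filter Topology

/-- The mean over `[c, d]` of the deviation of `F` from its affine approximation at `x`
with slope `f x`. -/
noncomputable def meanDev (f F : ℝ → ℝ) (c d x : ℝ) : ℝ :=
  1 / (d - c) * ∫ y in c..d, |F y - F x - f x * (y - x)|

/-- The gauge `δ` forces the mean deviations of fine divisions to sum up to less than `ε`. -/
def ControlsMeanDev (a b : ℝ) (f F δ : ℝ → ℝ) (ε : ℝ) : Prop :=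
  (∀ t ∈ Icc a b, 0 < δ t) ∧ ∀ (q : ℕ) (c d x : Fin q → ℝ),
    IsDivision a b c d x → IsFine δ c d x → ∑ i, meanDev f F (c i) (d i) (x i) < ε

/-- The points of `[a, b]` at which the gauge is at least `h` and `|f|` is at most `m`. -/
def gaugeLevel (a b : ℝ) (f δ : ℝ → ℝ) (h m : ℝ) : Set ℝ :=
  {x | x ∈ Icc a b ∧ h ≤ δ x ∧ |f x| ≤ m}

/-- Nonoverlapping intervals with endpoints in `C` and total length less than `η` carry a
variation of `F` of at most `M`. -/
def HasSmallVariationOn (F : ℝ → ℝ) (C : Set ℝ) (η M : ℝ) : Prop :=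
  ∀ (q : ℕ) (c d : Fin q → ℝ), (∀ i, c i ∈ C ∧ d i ∈ C ∧ c i < d i) →
    (Pairwise fun i j => Disjoint (Ioo (c i) (d i)) (Ioo (c j) (d j))) →
    ∑ i, (d i - c i) < η → ∑ i, |F (d i) - F (c i)| ≤ M

/-! ### Mean deviations and increments of the primitive -/

section MeanDeviation

variable {a b : ℝ} {f F : ℝ → ℝ}

theorem intervalIntegrable_dev (hF : IntegrableOn F (Icc a b)) {c d : ℝ}
    (hcd : c ≤ d) (hsub : Icc c d ⊆ Icc a b) (x : ℝ) :
    IntervalIntegrable (fun y => |F y - F x - f x * (y - x)|) volume c d := by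
  have h1 : IntervalIntegrable F volume c d := by
    rw [intervalIntegrable_iff_integrableOn_Icc_of_le hcd]
    exact hF.mono_set hsub
  have h2 : IntervalIntegrable (fun y => F x + f x * (y - x)) volume c d :=
    Continuous.intervalIntegrable (by fun_prop) _ _
  refine ((h1.sub h2).abs).congr ?_
  intro y _
  simp only [sub_sub]

theorem meanDev_nonneg {c d : ℝ} (hcd : c < d) (x : ℝ) : 0 ≤ meanDev f F c d x :=
  mul_nonneg (by rw [one_div, inv_nonneg]; linarith)
    (intervalIntegral.integral_nonneg hcd.le fun y _ => abs_nonneg _)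

/-- Jensen's inequality for `t ^ r` on the average over `[c, d]`; it reduces the problem to `r = 1`.
-/
theorem meanDev_le_rpow {r : ℝ} (hr : 1 ≤ r)
    (hF : MemLp F (ENNReal.ofReal r) (volume.restrict (Icc a b)))
    {c d : ℝ} (hcd : c < d) (hsub : Icc c d ⊆ Icc a b) (x : ℝ) :
    meanDev f F c d x ≤
      (1 / (d - c) * ∫ y in c..d, |F y - F x - f x * (y - x)| ^ r) ^ (1 / r) := by
  have hr0 : 0 < r := by linarith
  set g : ℝ → ℝ := fun y => F y - F x - f x * (y - x) with hg
  have hsub' : Ioc c d ⊆ Icc a b := Ioc_subset_Icc_self.trans hsub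
  have hgm : MemLp g (ENNReal.ofReal r) (volume.restrict (Ioc c d)) := by
    have h1 : MemLp F (ENNReal.ofReal r) (volume.restrict (Ioc c d)) :=
      hF.mono_measure (Measure.restrict_mono hsub' le_rfl)
    have h2 : MemLp (fun y => F x + f x * (y - x)) (ENNReal.ofReal r)
        (volume.restrict (Ioc c d)) := by
      have hcont : Continuous fun y => F x + f x * (y - x) := by fun_prop
      obtain ⟨M, hM⟩ := isCompact_Icc.exists_bound_of_continuousOn (s := Icc c d) hcont.continuousOn
      refine MemLp.of_bound hcont.aestronglyMeasurable M ?_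
      filter_upwards [ae_restrict_mem measurableSet_Ioc] with y hy
      exact hM y (Ioc_subset_Icc_self hy)
    have := h1.sub h2
    refine this.ae_eq (Eventually.of_forall fun y => ?_)
    simp [hg, sub_sub]
  have hpr : (ENNReal.ofReal r).toReal = r := ENNReal.toReal_ofReal hr0.le
  have hir : IntegrableOn ((fun t : ℝ => t ^ r) ∘ fun y => |g y|) (Ioc c d) := by
    have := hgm.integrable_norm_rpow (by simpa using hr0) ENNReal.ofReal_ne_top
    simpa [hpr, Function.comp_def, IntegrableOn] using this
  have hi1 : IntegrableOn (fun y => |g y|) (Ioc c d) := by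
    have := hgm.integrable (by simpa using hr)
    exact this.abs
  have hvol : (volume (Ioc c d)).toReal = d - c := by
    rw [Real.volume_Ioc, ENNReal.toReal_ofReal (by linarith)]
  have J := (convexOn_rpow hr).map_set_average_le (μ := volume) (t := Ioc c d)
    (f := fun y => |g y|)
    (by exact ContinuousOn.rpow_const continuousOn_id (fun y _ => Or.inr hr0.le)) isClosed_Ici
    (by rw [Real.volume_Ioc]; simpa using hcd) (by simp)
    (Eventually.of_forall fun y => mem_Ici.2 (abs_nonneg _)) hi1 hir
  rw [setAverage_eq, setAverage_eq, Measure.real, hvol, smul_eq_mul, smul_eq_mul,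
    ← intervalIntegral.integral_of_le hcd.le, ← intervalIntegral.integral_of_le hcd.le] at J
  rw [one_div r, Real.le_rpow_inv_iff_of_pos (meanDev_nonneg hcd x) _ hr0]
  · simpa [meanDev, one_div] using J
  · exact mul_nonneg (by rw [one_div, inv_nonneg]; linarith)
      (intervalIntegral.integral_nonneg hcd.le fun y _ => by positivity)

theorem IsHKrPrimitive.integrableOn {r : ℝ} (hr : 1 ≤ r) (h : IsHKrPrimitive r a b f F) :
    IntegrableOn F (Icc a b) :=
  h.1.integrable (by simpa using hr)

theorem IsHKrPrimitive.exists_controlsMeanDev {r : ℝ} (hr : 1 ≤ r)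
    (h : IsHKrPrimitive r a b f F) {ε : ℝ} (hε : 0 < ε) :
    ∃ δ, ControlsMeanDev a b f F δ ε := by
  obtain ⟨δ, hδ, H⟩ := h.2 ε hε
  refine ⟨δ, hδ, fun q c d x hdiv hfine => lt_of_le_of_lt ?_ (H q c d x hdiv hfine)⟩
  exact Finset.sum_le_sum fun i _ => meanDev_le_rpow hr h.1 (hdiv.lt i) (hdiv.subset i) _

theorem le_mean_add_mean {c d K M : ℝ} {u v : ℝ → ℝ} (hcd : c < d)
    (hu : IntervalIntegrable u volume c d) (hv : IntervalIntegrable v volume c d)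
    (h : ∀ t ∈ Icc c d, K ≤ u t + v t + M) :
    K ≤ 1 / (d - c) * (∫ t in c..d, u t) + 1 / (d - c) * (∫ t in c..d, v t) + M := by
  have h0 : 0 < d - c := sub_pos.2 hcd
  have key : ∫ _t in c..d, K ≤ ∫ t in c..d, (u t + v t + M) :=
    intervalIntegral.integral_mono_on hcd.le (by simp) ((hu.add hv).add (by simp)) h
  rw [intervalIntegral.integral_add (hu.add hv) (by simp), intervalIntegral.integral_add hu hv,
    intervalIntegral.integral_const, intervalIntegral.integral_const, smul_eq_mul,
    smul_eq_mul] at key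
  have : K ≤ 1 / (d - c) * ((∫ t in c..d, u t) + (∫ t in c..d, v t) + (d - c) * M) := by
    rw [one_div, ← div_eq_inv_mul, le_div_iff₀ h0]
    linarith
  calc K ≤ _ := this
    _ = _ := by field_simp

/-- Subtract the affine approximations at `c` and at `d` and average over `t`: the slope terms
combine to `f c * (t - c) + f d * (d - t)`. -/
theorem abs_sub_le_meanDev_add_meanDev (hF : IntegrableOn F (Icc a b)) {c d m : ℝ}
    (hcd : c < d) (hsub : Icc c d ⊆ Icc a b) (hc : |f c| ≤ m) (hd : |f d| ≤ m) :
    |F d - F c| ≤ meanDev f F c d c + meanDev f F c d d + m * (d - c) := by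
  refine le_mean_add_mean hcd (intervalIntegrable_dev hF hcd.le hsub c)
    (intervalIntegrable_dev hF hcd.le hsub d) fun t ht => ?_
  have e : F d - F c = (F t - F c - f c * (t - c)) - (F t - F d - f d * (t - d))
      + (f c * (t - c) + f d * (d - t)) := by ring
  have h1 : |f c * (t - c) + f d * (d - t)| ≤ m * (d - c) := by
    refine (abs_add_le _ _).trans ?_
    rw [abs_mul, abs_mul, abs_of_nonneg (sub_nonneg.2 ht.1), abs_of_nonneg (sub_nonneg.2 ht.2)]
    nlinarith [ht.1, ht.2]
  rw [e]
  have h2 := abs_add_le ((F t - F c - f c * (t - c)) - (F t - F d - f d * (t - d)))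
    (f c * (t - c) + f d * (d - t))
  have h3 := abs_sub (F t - F c - f c * (t - c)) (F t - F d - f d * (t - d))
  linarith

/-- Averaging over only half of `[u, v]` lets the interval tagged at `y` stay away from `x`; passing
to the mean over all of `[u, v]` for the tag `x` costs the factor 2. -/
theorem abs_sub_le_meanDev_add_two_mul (hF : IntegrableOn F (Icc a b)) {c d u v x y : ℝ}
    (hcd : c < d) (hI : Icc c d ⊆ Icc u v) (hsub : Icc u v ⊆ Icc a b)
    (hlen : d - c = (v - u) / 2) (hy : y ∈ Icc c d) (hx : x ∈ Icc u v) :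
    |F y - F x| ≤ meanDev f F c d y + 2 * meanDev f F u v x + (|f y| + |f x|) * (v - u) := by
  have huv : u < v := by linarith
  have hcu : u ≤ c := (hI (left_mem_Icc.2 hcd.le)).1
  have hdv : d ≤ v := (hI (right_mem_Icc.2 hcd.le)).2
  have step : |F y - F x| ≤ meanDev f F c d y + meanDev f F c d x
      + (|f y| + |f x|) * (v - u) := by
    refine le_mean_add_mean hcd (intervalIntegrable_dev hF hcd.le (hI.trans hsub) y)
      (intervalIntegrable_dev hF hcd.le (hI.trans hsub) x) fun t ht => ?_
    have e : F y - F x = (F t - F x - f x * (t - x)) - (F t - F y - f y * (t - y))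
        + (f x * (t - x) + f y * (y - t)) := by ring
    have htx : |t - x| ≤ v - u := by
      rw [abs_le]; constructor <;> linarith [hx.1, hx.2, ht.1, ht.2]
    have hty : |y - t| ≤ v - u := by
      rw [abs_le]; constructor <;> linarith [hy.1, hy.2, ht.1, ht.2]
    have h1 : |f x * (t - x) + f y * (y - t)| ≤ (|f y| + |f x|) * (v - u) := by
      refine (abs_add_le _ _).trans ?_
      rw [abs_mul, abs_mul]
      nlinarith [abs_nonneg (f x), abs_nonneg (f y)]
    rw [e]
    have h2 := abs_add_le ((F t - F x - f x * (t - x)) - (F t - F y - f y * (t - y)))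
      (f x * (t - x) + f y * (y - t))
    have h3 := abs_sub (F t - F x - f x * (t - x)) (F t - F y - f y * (t - y))
    linarith
  have hmono : meanDev f F c d x ≤ 2 * meanDev f F u v x := by
    have hi : ∫ y in c..d, |F y - F x - f x * (y - x)|
        ≤ ∫ y in u..v, |F y - F x - f x * (y - x)| :=
      intervalIntegral.integral_mono_interval hcu hcd.le hdv
        (Eventually.of_forall fun y => abs_nonneg _) (intervalIntegrable_dev hF huv.le hsub x)
    have h0 : 0 < v - u := sub_pos.2 huv
    unfold meanDev
    rw [hlen]
    calc 1 / ((v - u) / 2) * ∫ y in c..d, |F y - F x - f x * (y - x)|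
        ≤ 1 / ((v - u) / 2) * ∫ y in u..v, |F y - F x - f x * (y - x)| := by gcongr
      _ = _ := by field_simp
  linarith

/-- A single fine interval has small mean deviation. -/
theorem ControlsMeanDev.meanDev_lt {δ : ℝ → ℝ} {ε : ℝ} (G : ControlsMeanDev a b f F δ ε)
    {c d x : ℝ} (hcd : c < d) (hsub : Icc c d ⊆ Icc a b) (hx : x ∈ Icc c d) (hlen : d - c < δ x) :
    meanDev f F c d x < ε := by
  have := G.2 1 (fun _ => c) (fun _ => d) (fun _ => x)
    ⟨fun _ => hcd, fun _ => hsub, fun _ => hx, fun i j hij => (hij (Subsingleton.elim _ _)).elim⟩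
    (fun _ t ht => ⟨by linarith [hx.1, hx.2, ht.1, ht.2], by linarith [hx.1, hx.2, ht.1, ht.2]⟩)
  simpa using this

/-- The gauge is at least `h` at both endpoints, so the family is fine when tagged at all left ends
and again at all right ends; hence `2 * ε`. -/
theorem ControlsMeanDev.sum_abs_sub_le {δ : ℝ → ℝ} {ε h m : ℝ} (G : ControlsMeanDev a b f F δ ε)
    (hF : IntegrableOn F (Icc a b)) {q : ℕ} {c d : Fin q → ℝ}
    (hE : ∀ i, c i ∈ gaugeLevel a b f δ h m ∧ d i ∈ gaugeLevel a b f δ h m ∧ c i < d i)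
    (hdisj : Pairwise fun i j => Disjoint (Ioo (c i) (d i)) (Ioo (c j) (d j)))
    (hlen : ∀ i, d i - c i < h) :
    ∑ i, |F (d i) - F (c i)| ≤ 2 * ε + m * ∑ i, (d i - c i) := by
  have hsub : ∀ i, Icc (c i) (d i) ⊆ Icc a b := fun i =>
    Icc_subset_Icc (hE i).1.1.1 (hE i).2.1.1.2
  have h1 := G.2 q c d c ⟨fun i => (hE i).2.2, hsub, fun i => left_mem_Icc.2 (hE i).2.2.le, hdisj⟩
    (fun i t ht => by
      have := (hE i).1.2.1
      have := hlen i
      exact ⟨by linarith [ht.1, (hE i).2.2], by linarith [ht.2]⟩)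
  have h2 := G.2 q c d d ⟨fun i => (hE i).2.2, hsub, fun i => right_mem_Icc.2 (hE i).2.2.le, hdisj⟩
    (fun i t ht => by
      have := (hE i).2.1.2.1
      have := hlen i
      exact ⟨by linarith [ht.1], by linarith [ht.2, (hE i).2.2]⟩)
  calc ∑ i, |F (d i) - F (c i)|
      ≤ ∑ i, (meanDev f F (c i) (d i) (c i) + meanDev f F (c i) (d i) (d i) + m * (d i - c i)) :=
        Finset.sum_le_sum fun i _ => abs_sub_le_meanDev_add_meanDev hF (hE i).2.2 (hsub i)
          (hE i).1.2.2 (hE i).2.1.2.2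
    _ = _ + _ + m * ∑ i, (d i - c i) := by
        rw [Finset.sum_add_distrib, Finset.sum_add_distrib, Finset.mul_sum]
    _ ≤ _ := by linarith

end MeanDeviation

theorem gaugeLevel_subset {a b : ℝ} {f δ : ℝ → ℝ} {h m : ℝ} : gaugeLevel a b f δ h m ⊆ Icc a b :=
  fun _ hx => hx.1

theorem closure_gaugeLevel_subset {a b : ℝ} {f δ : ℝ → ℝ} {h m : ℝ} :
    closure (gaugeLevel a b f δ h m) ⊆ Icc a b :=
  closure_minimal gaugeLevel_subset isClosed_Icc

/-! ### Passage to the closure of a gauge level -/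

section Closure

variable {a b : ℝ} {f F δ : ℝ → ℝ} {ε h m : ℝ}

/-- Near `x`, every point of a gauge level at which `F` is far from `F x` is the tag of an interval
of large mean deviation, which stays away from `x`. -/
theorem exists_interval_large_meanDev (H : ∀ ε > 0, ∃ δ, ControlsMeanDev a b f F δ ε)
    (hF : IntegrableOn F (Icc a b)) (hh : 0 < h) {x ε₁ : ℝ} (hx : x ∈ Icc a b) (hε₁ : 0 < ε₁) :
    ∃ ρ > 0, ∀ y ∈ gaugeLevel a b f δ h m, |y - x| < ρ → ε₁ ≤ |F y - F x| →
      ∃ c d, c < d ∧ Icc c d ⊆ Icc a b ∧ y ∈ Icc c d ∧ d - c < h ∧ ε₁ / 2 ≤ meanDev f F c d y ∧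
        ∀ t ∈ Icc c d, |y - x| / 2 ≤ |t - x| ∧ |t - x| ≤ |y - x| := by
  -- Out of `ε₁`, the deviation at `x` takes `2 * (ε₁ / 8)` and the slopes take `ε₁ / 4`, which
  -- leaves `ε₁ / 2` for the deviation at `y`.
  obtain ⟨δ', hδ', G'⟩ := H (ε₁ / 8) (by linarith)
  set K := |m| + |f x| + 1 with hK
  have hKpos : 0 < K := by positivity
  refine ⟨min (δ' x) (min h (ε₁ / (4 * K))),
    lt_min (hδ' x hx) (lt_min hh (by positivity)), fun y hy hyx hFy => ?_⟩
  obtain ⟨h1, h2, h3⟩ : |y - x| < δ' x ∧ |y - x| < h ∧ |y - x| < ε₁ / (4 * K) := by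
    simpa [lt_min_iff] using hyx
  have hne : y ≠ x := by
    rintro rfl
    simp only [sub_self, abs_zero] at hFy
    linarith
  have hsmall : (|f y| + |f x|) * |y - x| ≤ ε₁ / 4 := by
    rw [lt_div_iff₀ (by positivity)] at h3
    have : |f y| + |f x| ≤ K := by
      have := hy.2.2.trans (le_abs_self m)
      linarith
    nlinarith [abs_nonneg (y - x)]
  have aux : ∀ u v c d, c < d → Icc c d ⊆ Icc u v → Icc u v ⊆ Icc a b → d - c = (v - u) / 2 →
      y ∈ Icc c d → x ∈ Icc u v → v - u = |y - x| → ε₁ / 2 ≤ meanDev f F c d y := by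
    intro u v c d hcd hI hsub hlen hyI hxI hl
    have A := abs_sub_le_meanDev_add_two_mul hF hcd hI hsub hlen hyI hxI (f := f)
    have B := ControlsMeanDev.meanDev_lt ⟨hδ', G'⟩ (by linarith : u < v) hsub hxI (by linarith)
    rw [hl] at A
    linarith
  rcases lt_or_gt_of_ne hne with hlt | hgt
  · have e : |y - x| = x - y := by rw [abs_sub_comm, abs_of_pos (sub_pos.2 hlt)]
    have hsub : Icc y x ⊆ Icc a b := Icc_subset_Icc hy.1.1 hx.2
    have hI : Icc y ((x + y) / 2) ⊆ Icc y x := Icc_subset_Icc le_rfl (by linarith)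
    have hcd : y < (x + y) / 2 := by linarith
    refine ⟨y, (x + y) / 2, hcd, hI.trans hsub, left_mem_Icc.2 hcd.le, by linarith,
      aux y x _ _ hcd hI hsub (by ring) (left_mem_Icc.2 hcd.le) (right_mem_Icc.2 hlt.le) e.symm,
      fun t ht => ?_⟩
    have e' : |t - x| = x - t := by
      rw [abs_sub_comm, abs_of_nonneg]
      linarith [ht.2]
    rw [e, e']
    constructor <;> linarith [ht.1, ht.2]
  · have e : |y - x| = y - x := abs_of_pos (sub_pos.2 hgt)
    have hsub : Icc x y ⊆ Icc a b := Icc_subset_Icc hx.1 hy.1.2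
    have hI : Icc ((x + y) / 2) y ⊆ Icc x y := Icc_subset_Icc (by linarith) le_rfl
    have hcd : (x + y) / 2 < y := by linarith
    refine ⟨(x + y) / 2, y, hcd, hI.trans hsub, right_mem_Icc.2 hcd.le, by linarith,
      aux x y _ _ hcd hI hsub (by ring) (right_mem_Icc.2 hcd.le) (left_mem_Icc.2 hgt.le) e.symm,
      fun t ht => ?_⟩
    have e' : |t - x| = t - x := by
      rw [abs_of_nonneg]
      linarith [ht.1]
    rw [e, e']
    constructor <;> linarith [ht.1, ht.2]

theorem tendsto_nhdsWithin_gaugeLevel (H : ∀ ε > 0, ∃ δ, ControlsMeanDev a b f F δ ε)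
    (hF : IntegrableOn F (Icc a b)) (G : ControlsMeanDev a b f F δ ε) (hh : 0 < h) {x : ℝ}
    (hx : x ∈ Icc a b) :
    Tendsto F (𝓝[gaugeLevel a b f δ h m] x) (𝓝 (F x)) := by
  rw [Metric.tendsto_nhdsWithin_nhds]
  by_contra hcon
  push Not at hcon
  obtain ⟨ε₁, hε₁, bad⟩ := hcon
  obtain ⟨ρ, hρ, large⟩ := exists_interval_large_meanDev (δ := δ) (m := m) H hF hh hx hε₁
  have step : ∀ σ > 0, ∃ p : ℝ × ℝ × ℝ, p.2.2 ∈ gaugeLevel a b f δ h m ∧ 0 < |p.2.2 - x| ∧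
      |p.2.2 - x| < σ ∧ p.1 < p.2.1 ∧ Icc p.1 p.2.1 ⊆ Icc a b ∧ p.2.2 ∈ Icc p.1 p.2.1 ∧
      p.2.1 - p.1 < h ∧ ε₁ / 2 ≤ meanDev f F p.1 p.2.1 p.2.2 ∧
      ∀ t ∈ Icc p.1 p.2.1, |p.2.2 - x| / 2 ≤ |t - x| ∧ |t - x| ≤ |p.2.2 - x| := by
    intro σ hσ
    obtain ⟨y, hy, hyd, hFy⟩ := bad (min σ ρ) (lt_min hσ hρ)
    rw [Real.dist_eq] at hyd hFy
    obtain ⟨c, d, h1, h2, h3, h4, h5, h6⟩ := large y hy (hyd.trans_le (min_le_right _ _)) hFy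
    refine ⟨(c, d, y), hy, abs_pos.2 (sub_ne_zero.2 ?_), hyd.trans_le (min_le_left _ _),
      h1, h2, h3, h4, h5, h6⟩
    rintro rfl
    simp only [sub_self, abs_zero] at hFy
    linarith
  choose! s hs using step
  -- Each new tag is less than half as far from `x` as the previous one. The interval of a tag at
  -- distance `ρ` lies at distances between `ρ / 2` and `ρ`, so the intervals are disjoint.
  let p : ℕ → ℝ × ℝ × ℝ := fun k => Nat.rec (s 1) (fun _ q => s (|q.2.2 - x| / 2)) k
  have hpos : ∀ k, 0 < |(p k).2.2 - x| := by
    intro k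
    induction k with
    | zero => exact (hs 1 one_pos).2.1
    | succ k ih => exact (hs (|(p k).2.2 - x| / 2) (half_pos ih)).2.1
  have good : ∀ k, ∃ σ > 0, p k = s σ := by
    intro k
    cases k with
    | zero => exact ⟨1, one_pos, rfl⟩
    | succ k => exact ⟨_, half_pos (hpos k), rfl⟩
  have hdec : ∀ k, |(p (k + 1)).2.2 - x| < |(p k).2.2 - x| / 2 := fun k =>
    (hs _ (half_pos (hpos k))).2.2.1
  have hanti : Antitone fun k => |(p k).2.2 - x| :=
    antitone_nat_of_succ_le fun k => by linarith [hdec k, hpos k]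
  have hlt : ∀ j k, j < k → |(p k).2.2 - x| < |(p j).2.2 - x| / 2 := fun j k hjk =>
    (hanti (Nat.succ_le_of_lt hjk)).trans_lt (hdec j)
  have hp : ∀ k, (p k).2.2 ∈ gaugeLevel a b f δ h m ∧ (p k).1 < (p k).2.1 ∧
      Icc (p k).1 (p k).2.1 ⊆ Icc a b ∧ (p k).2.2 ∈ Icc (p k).1 (p k).2.1 ∧
      (p k).2.1 - (p k).1 < h ∧ ε₁ / 2 ≤ meanDev f F (p k).1 (p k).2.1 (p k).2.2 ∧
      ∀ t ∈ Icc (p k).1 (p k).2.1, |(p k).2.2 - x| / 2 ≤ |t - x| ∧ |t - x| ≤ |(p k).2.2 - x| := by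
    intro k
    obtain ⟨σ, hσ, e⟩ := good k
    obtain ⟨h1, -, -, h4⟩ := hs σ hσ
    rw [e]
    exact ⟨h1, h4⟩
  have hdisj : ∀ j k, j < k →
      Disjoint (Ioo (p j).1 (p j).2.1) (Ioo (p k).1 (p k).2.1) := by
    intro j k hjk
    rw [Set.disjoint_left]
    intro t htj htk
    have h1 := ((hp j).2.2.2.2.2.2 t (Ioo_subset_Icc_self htj)).1
    have h2 := ((hp k).2.2.2.2.2.2 t (Ioo_subset_Icc_self htk)).2
    linarith [hlt j k hjk]
  obtain ⟨N, hN⟩ := exists_nat_ge (ε / (ε₁ / 2))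
  rw [div_le_iff₀ (by linarith)] at hN
  have key := G.2 N (fun i => (p i).1) (fun i => (p i).2.1) (fun i => (p i).2.2)
    ⟨fun i => (hp i).2.1, fun i => (hp i).2.2.1, fun i => (hp i).2.2.2.1, fun i j hij => by
      rcases lt_or_gt_of_ne (Fin.val_ne_of_ne hij) with hl | hl
      · exact hdisj _ _ hl
      · exact (hdisj _ _ hl).symm⟩
    (fun i t ht => by
      obtain ⟨h1, -, -, h2, h3, -⟩ := hp i
      have := h1.2.1
      exact ⟨by linarith [ht.1, h2.2], by linarith [ht.2, h2.1]⟩)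
  have : ∑ _i : Fin N, ε₁ / 2 ≤ ∑ i : Fin N, meanDev f F (p i).1 (p i).2.1 (p i).2.2 :=
    Finset.sum_le_sum fun i _ => (hp i).2.2.2.2.2.1
  simp only [Finset.sum_const, Finset.card_univ, Fintype.card_fin, nsmul_eq_mul] at this
  linarith

/-- If `F` has at each point of `closure E` the limit `F x` along `E`, then it is continuous on
`closure E`. -/
theorem continuousOn_closure_of_tendsto {E : Set ℝ}
    (hE : ∀ x ∈ closure E, Tendsto F (𝓝[E] x) (𝓝 (F x))) : ContinuousOn F (closure E) := by
  intro x hx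
  refine Metric.tendsto_nhdsWithin_nhds.2 fun θ hθ => ?_
  obtain ⟨ρ, hρ, hρE⟩ := Metric.tendsto_nhdsWithin_nhds.1 (hE x hx) (θ / 2) (half_pos hθ)
  refine ⟨ρ, hρ, fun z hz hzx => ?_⟩
  obtain ⟨ρ', hρ', hρE'⟩ := Metric.tendsto_nhdsWithin_nhds.1 (hE z hz) (θ / 2) (half_pos hθ)
  obtain ⟨y, hy, hyz⟩ := Metric.mem_closure_iff.1 hz (min ρ' (ρ - dist z x))
    (lt_min hρ' (sub_pos.2 hzx))
  rw [lt_min_iff] at hyz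
  have h1 : dist (F y) (F z) < θ / 2 := hρE' hy (by rw [dist_comm]; exact hyz.1)
  have h2 : dist (F y) (F x) < θ / 2 :=
    hρE hy (by have := dist_triangle y z x; rw [dist_comm y z] at this; linarith [hyz.2])
  have := dist_triangle_left (F z) (F x) (F y)
  linarith

theorem ControlsMeanDev.sum_abs_sub_le_closure
    (H : ∀ ε > 0, ∃ δ, ControlsMeanDev a b f F δ ε)
    (G : ControlsMeanDev a b f F δ ε)
    (hF : IntegrableOn F (Icc a b)) (hh : 0 < h) {q : ℕ} {c d : Fin q → ℝ}
    (hE : ∀ i, c i ∈ closure (gaugeLevel a b f δ h m) ∧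
      d i ∈ closure (gaugeLevel a b f δ h m) ∧ c i < d i)
    (hdisj : Pairwise fun i j => Disjoint (Ioo (c i) (d i)) (Ioo (c j) (d j)))
    (hlen : ∀ i, d i - c i < h) :
    ∑ i, |F (d i) - F (c i)| ≤ 2 * ε + m * ∑ i, (d i - c i) := by
  set E := gaugeLevel a b f δ h m with hEdef
  have hseq : ∀ x ∈ closure E, ∃ u : ℕ → ℝ, (∀ k, u k ∈ E) ∧ Tendsto u atTop (𝓝 x) ∧
      Tendsto (fun k => F (u k)) atTop (𝓝 (F x)) := by
    intro x hx
    obtain ⟨u, hu, hux⟩ := mem_closure_iff_seq_limit.1 hx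
    exact ⟨u, hu, hux, (tendsto_nhdsWithin_gaugeLevel H hF G hh
      (closure_gaugeLevel_subset hx)).comp
        (tendsto_nhdsWithin_iff.2 ⟨hux, Eventually.of_forall hu⟩)⟩
  -- The sequence depends only on the point, so a common endpoint of two intervals stays common and
  -- the approximating intervals do not overlap.
  choose! u huE hu hFu using hseq
  have hlt : ∀ x ∈ closure E, ∀ y ∈ closure E, x < y → ∀ᶠ k in atTop, u x k < u y k :=
    fun x hx y hy hxy => (hu x hx).eventually_lt (hu y hy) hxy
  have hle : ∀ x ∈ closure E, ∀ y ∈ closure E, x ≤ y → ∀ᶠ k in atTop, u x k ≤ u y k := by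
    intro x hx y hy hxy
    rcases hxy.eq_or_lt with rfl | hxy
    · exact Eventually.of_forall fun k => le_rfl
    · exact (hlt x hx y hy hxy).mono fun k hk => hk.le
  have ev1 : ∀ᶠ k in atTop, ∀ i, u (c i) k < u (d i) k :=
    eventually_all.2 fun i => hlt _ (hE i).1 _ (hE i).2.1 (hE i).2.2
  have ev2 : ∀ᶠ k in atTop, ∀ i, u (d i) k - u (c i) k < h :=
    eventually_all.2 fun i =>
      ((hu _ (hE i).2.1).sub (hu _ (hE i).1)).eventually_lt tendsto_const_nhds (hlen i)
  have ev3 : ∀ᶠ k in atTop, ∀ i j, i ≠ j →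
      Disjoint (Ioo (u (c i) k) (u (d i) k)) (Ioo (u (c j) k) (u (d j) k)) := by
    refine eventually_all.2 fun i => eventually_all.2 fun j => ?_
    by_cases hij : i = j
    · exact Eventually.of_forall fun k hne => (hne hij).elim
    have hd : Disjoint (Ioo (c i) (d i)) (Ioo (c j) (d j)) := hdisj hij
    rw [Ioo_disjoint_Ioo] at hd
    have : d i ≤ c j ∨ d j ≤ c i := by
      have hi := (hE i).2.2
      have hj := (hE j).2.2
      rw [min_le_iff, le_max_iff, le_max_iff] at hd
      rcases hd with (hd | hd) | (hd | hd)
      · exact (hi.not_ge hd).elim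
      · exact Or.inl hd
      · exact Or.inr hd
      · exact (hj.not_ge hd).elim
    rcases this with hl | hl
    · filter_upwards [hle _ (hE i).2.1 _ (hE j).1 hl] with k hk _
      rw [Ioo_disjoint_Ioo]
      exact (min_le_left _ _).trans (hk.trans (le_max_right _ _))
    · filter_upwards [hle _ (hE j).2.1 _ (hE i).1 hl] with k hk _
      rw [Ioo_disjoint_Ioo]
      exact (min_le_right _ _).trans (hk.trans (le_max_left _ _))
  have lim1 : Tendsto (fun k => ∑ i, |F (u (d i) k) - F (u (c i) k)|) atTop
      (𝓝 (∑ i, |F (d i) - F (c i)|)) :=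
    tendsto_finsetSum _ fun i _ => ((hFu _ (hE i).2.1).sub (hFu _ (hE i).1)).abs
  have lim2 : Tendsto (fun k => 2 * ε + m * ∑ i, (u (d i) k - u (c i) k)) atTop
      (𝓝 (2 * ε + m * ∑ i, (d i - c i))) :=
    tendsto_const_nhds.add (tendsto_const_nhds.mul
      (tendsto_finsetSum _ fun i _ => (hu _ (hE i).2.1).sub (hu _ (hE i).1)))
  refine le_of_tendsto_of_tendsto lim1 lim2 ?_
  filter_upwards [ev1, ev2, ev3] with k h1 h2 h3
  exact G.sum_abs_sub_le hF (fun i => ⟨huE _ (hE i).1 k, huE _ (hE i).2.1 k, h1 i⟩)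
    (fun i j hij => h3 i j hij) h2

/-- Total length below `h` makes each interval short enough for the gauge; below `ε / m` it makes
the slope term less than `ε`. -/
theorem ControlsMeanDev.hasSmallVariationOn
    (H : ∀ ε > 0, ∃ δ, ControlsMeanDev a b f F δ ε)
    (G : ControlsMeanDev a b f F δ ε)
    (hF : IntegrableOn F (Icc a b)) (hh : 0 < h) (hm : 0 < m) :
    HasSmallVariationOn F (closure (gaugeLevel a b f δ h m)) (min h (ε / m)) (3 * ε) := by
  intro q c d hE hdisj hsum
  rw [lt_min_iff, lt_div_iff₀ hm] at hsum
  have hlen : ∀ i, d i - c i < h := fun i =>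
    (Finset.single_le_sum (f := fun i => d i - c i)
      (fun j _ => (sub_pos.2 (hE j).2.2).le) (Finset.mem_univ i)).trans_lt hsum.1
  have := G.sum_abs_sub_le_closure H hF hh hE hdisj hlen
  linarith

end Closure

/-! ### From small variation to bounded variation -/

section SmallVariation

variable {F : ℝ → ℝ} {C D : Set ℝ} {η M : ℝ}

theorem HasSmallVariationOn.mono (h : HasSmallVariationOn F C η M) (hD : D ⊆ C) :
    HasSmallVariationOn F D η M :=
  fun q c d hE => h q c d fun i => ⟨hD (hE i).1, hD (hE i).2.1, (hE i).2.2⟩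

/-- Version for finite families of possibly degenerate intervals. -/
theorem HasSmallVariationOn.sum_le (h : HasSmallVariationOn F C η M) {ι : Type*} (s : Finset ι)
    {c d : ι → ℝ} (hE : ∀ i ∈ s, c i ∈ C ∧ d i ∈ C ∧ c i ≤ d i)
    (hdisj : ∀ i ∈ s, ∀ j ∈ s, i ≠ j → Disjoint (Ioo (c i) (d i)) (Ioo (c j) (d j)))
    (hsum : ∑ i ∈ s, (d i - c i) < η) : ∑ i ∈ s, |F (d i) - F (c i)| ≤ M := by
  classical
  set t := s.filter fun i => c i < d i with ht
  let e : Fin t.card ≃ t := t.equivFin.symm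
  have hts : ∀ i : t, (i : ι) ∈ s ∧ c i < d i := fun i =>
    Finset.mem_filter.1 i.2
  have hout : ∀ i ∈ s, i ∉ t → c i = d i := fun i his hit => by
    rw [ht, Finset.mem_filter, not_and, not_lt] at hit
    exact le_antisymm (hE i his).2.2 (hit his)
  have tr : ∀ g : ι → ℝ, (∀ i ∈ s, i ∉ t → g i = 0) → ∑ i ∈ s, g i = ∑ k, g (e k) := by
    intro g hg
    rw [← Finset.sum_subset (Finset.filter_subset _ s) hg, ← Finset.sum_coe_sort,
      ← Equiv.sum_comp e]
  rw [tr _ fun i his hit => by rw [hout i his hit]; simp]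
  rw [tr _ fun i his hit => by rw [hout i his hit]; simp] at hsum
  refine h _ (fun k => c (e k)) (fun k => d (e k)) (fun k => ?_) (fun k l hkl => ?_) hsum
  · exact ⟨(hE _ (hts _).1).1, (hE _ (hts _).1).2.1, (hts _).2⟩
  · exact hdisj _ (hts _).1 _ (hts _).1 fun he => hkl (e.injective (Subtype.ext he))

/-- Every partition with points in `D` has total length at most `v - u`, so it is itself an
admissible family. -/
theorem HasSmallVariationOn.boundedVariationOn (h : HasSmallVariationOn F D η M) {u v : ℝ}
    (hD : D ⊆ Icc u v) (huv : v - u < η) : BoundedVariationOn F D := by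
  refine ne_top_of_le_ne_top (b := ENNReal.ofReal M) ENNReal.ofReal_ne_top (iSup_le ?_)
  rintro ⟨n, w, hw, hwD⟩
  have := h.sum_le (Finset.range n) (c := fun i => w i) (d := fun i => w (i + 1))
    (fun i _ => ⟨hwD _, hwD _, hw (Nat.le_succ i)⟩)
    (fun i _ j _ hij => by
      rw [Ioo_disjoint_Ioo]
      rcases lt_or_gt_of_ne hij with hl | hl
      · exact (min_le_left _ _).trans ((hw (Nat.succ_le_of_lt hl)).trans (le_max_right _ _))
      · exact (min_le_right _ _).trans ((hw (Nat.succ_le_of_lt hl)).trans (le_max_left _ _)))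
    (by
      rw [Finset.sum_range_sub]
      linarith [(hD (hwD n)).2, (hD (hwD 0)).1])
  simp only [edist_dist, Real.dist_eq]
  rw [← ENNReal.ofReal_sum_of_nonneg fun i _ => abs_nonneg _]
  exact ENNReal.ofReal_le_ofReal this

end SmallVariation

/-! ### Cumulative variation and short gaps -/

/-- The variation of `F` on the part of `D` up to `t`. -/
noncomputable def variationUpTo (F : ℝ → ℝ) (D : Set ℝ) (t : ℝ) : ℝ :=
  (eVariationOn F (D ∩ Iic t)).toReal

/-- The points of `D` that are the right endpoint of a gap of `D` of length less than `η`. -/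
def rightEndsOfShortGaps (D : Set ℝ) (η : ℝ) : Set ℝ :=
  {p | p ∈ D ∧ ∃ q ∈ D, q < p ∧ p - q < η ∧ D ∩ Ioo q p = ∅}

section ShortGaps

variable {D : Set ℝ} {η : ℝ}

theorem exists_lt_inter_Ioo_eq_empty {p : ℝ} (h : 𝓝[D ∩ Iio p] p = ⊥) :
    ∃ t < p, D ∩ Ioo t p = ∅ := by
  rw [← empty_mem_iff_bot, mem_nhdsWithin_iff_exists_mem_nhds_inter] at h
  obtain ⟨u, hu, hsub⟩ := h
  obtain ⟨l, r, ⟨hl, hr⟩, hlr⟩ := mem_nhds_iff_exists_Ioo_subset.1 hu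
  exact ⟨l, hl, subset_empty_iff.1 fun t ht =>
    hsub ⟨hlr ⟨ht.2.1, ht.2.2.trans hr⟩, ht.1, ht.2.2⟩⟩

theorem exists_gt_inter_Ioo_eq_empty {p : ℝ} (h : 𝓝[D ∩ Ioi p] p = ⊥) :
    ∃ t > p, D ∩ Ioo p t = ∅ := by
  rw [← empty_mem_iff_bot, mem_nhdsWithin_iff_exists_mem_nhds_inter] at h
  obtain ⟨u, hu, hsub⟩ := h
  obtain ⟨l, r, ⟨hl, hr⟩, hlr⟩ := mem_nhds_iff_exists_Ioo_subset.1 hu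
  exact ⟨r, hr, subset_empty_iff.1 fun t ht =>
    hsub ⟨hlr ⟨hl.trans ht.2.1, ht.2.2⟩, ht.1, ht.2.1⟩⟩

theorem countable_rightEndsOfShortGaps : (rightEndsOfShortGaps D η).Countable := by
  refine (countable_setOfPred_isolated_left_within (s := D)).mono ?_
  rintro p ⟨hp, q, -, hqp, -, he⟩
  refine ⟨hp, ?_⟩
  rw [← empty_mem_iff_bot, mem_nhdsWithin_iff_exists_mem_nhds_inter]
  refine ⟨Ioi q, Ioi_mem_nhds hqp, ?_⟩
  rintro t ⟨htq, htD, htp⟩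
  exact he.subset ⟨htD, htq, htp⟩

theorem antitone_rightEndsOfShortGaps :
    Antitone fun n : ℕ => rightEndsOfShortGaps D (1 / ((n : ℝ) + 1)) := by
  rintro k n hkn p ⟨hp, q, hq, hqp, hl, he⟩
  refine ⟨hp, q, hq, hqp, hl.trans_le ?_, he⟩
  exact one_div_le_one_div_of_le (by positivity) (by exact_mod_cast Nat.succ_le_succ hkn)

/-- A point ends at most one gap on its left, whose length is fixed: a shorter one would start
inside it. -/
theorem iInter_rightEndsOfShortGaps :
    ⋂ n : ℕ, rightEndsOfShortGaps D (1 / ((n : ℝ) + 1)) = ∅ := by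
  rw [eq_empty_iff_forall_notMem]
  intro p hp
  rw [mem_iInter] at hp
  obtain ⟨-, q, -, hqp, -, he⟩ := hp 0
  obtain ⟨n, hn⟩ := exists_nat_one_div_lt (sub_pos.2 hqp)
  obtain ⟨-, q', hq', hqp', hl, -⟩ := hp n
  exact he.subset ⟨hq', by linarith, hqp'⟩

/-- The gap before the left-isolated point `p` cannot reach beyond `c`; its left end is the last
point of `D` in `[c, t]`, where `D` misses `(t, p)`. -/
theorem mem_rightEndsOfShortGaps (hD : IsClosed D) {c p : ℝ} (hc : c ∈ D) (hp : p ∈ D)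
    (hcp : c < p) (hη : p - c < η) (h : 𝓝[D ∩ Iio p] p = ⊥) : p ∈ rightEndsOfShortGaps D η := by
  obtain ⟨t, htp, ht⟩ := exists_lt_inter_Ioo_eq_empty h
  have hct : c ≤ t := by
    by_contra! htc
    exact ht.subset ⟨hc, htc, hcp⟩
  obtain ⟨q, ⟨hqD, hcq, hqt⟩, hq⟩ := (isCompact_Icc.inter_left hD).exists_isGreatest
    (s := D ∩ Icc c t) ⟨c, hc, le_rfl, hct⟩
  refine ⟨hp, q, hqD, hqt.trans_lt htp, by linarith, ?_⟩
  rw [eq_empty_iff_forall_notMem]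
  rintro s ⟨hsD, hqs, hsp⟩
  rcases le_or_gt s t with hst | hst
  · exact (hq ⟨hsD, hcq.trans hqs.le, hst⟩).not_gt hqs
  · exact ht.subset ⟨hsD, hst, hsp⟩

end ShortGaps

/-! ### The variation measure and absolute continuity -/

section VariationMeasure

variable {F : ℝ → ℝ} {D : Set ℝ}

theorem monotone_variationUpTo (hBV : BoundedVariationOn F D) : Monotone (variationUpTo F D) :=
  fun _ _ hst => ENNReal.toReal_mono (hBV.mono inter_subset_left)
    (eVariationOn.mono F (inter_subset_inter_right _ (Iic_subset_Iic.2 hst)))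

theorem abs_variationUpTo_le (hBV : BoundedVariationOn F D) (t : ℝ) :
    |variationUpTo F D t| ≤ (eVariationOn F D).toReal := by
  rw [abs_of_nonneg (by exact ENNReal.toReal_nonneg)]
  exact ENNReal.toReal_mono hBV (eVariationOn.mono F inter_subset_left)

theorem abs_sub_le_variationUpTo (hBV : BoundedVariationOn F D) {x y : ℝ} (hx : x ∈ D)
    (hy : y ∈ D) (hxy : x ≤ y) :
    |F y - F x| ≤ variationUpTo F D y - variationUpTo F D x := by
  have h1 : eVariationOn F (D ∩ Iic x) + eVariationOn F (D ∩ Icc x y)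
      ≤ eVariationOn F (D ∩ Iic y) := by
    refine (eVariationOn.add_le_union F fun s hs t ht => hs.2.trans ht.2.1).trans ?_
    refine eVariationOn.mono F ?_
    rintro t (ht | ht)
    · exact ⟨ht.1, ht.2.trans hxy⟩
    · exact ⟨ht.1, ht.2.2⟩
  have h2 : |F y - F x| ≤ (eVariationOn F (D ∩ Icc x y)).toReal := by
    rw [← Real.dist_eq]
    exact (hBV.mono inter_subset_left).dist_le ⟨hy, hxy, le_rfl⟩ ⟨hx, le_rfl, hxy⟩
  have h3 := ENNReal.toReal_mono (hBV.mono inter_subset_left) h1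
  rw [ENNReal.toReal_add (hBV.mono inter_subset_left) (hBV.mono inter_subset_left)] at h3
  unfold variationUpTo
  linarith

theorem variationUpTo_eq {s t : ℝ} (hst : s ≤ t) (h : D ∩ Ioc s t = ∅) :
    variationUpTo F D s = variationUpTo F D t := by
  have : D ∩ Iic s = D ∩ Iic t := by
    ext x
    refine ⟨fun hx => ⟨hx.1, hx.2.trans hst⟩, fun hx => ⟨hx.1, ?_⟩⟩
    by_contra hxs
    exact h.subset ⟨hx.1, not_le.1 hxs, hx.2⟩
  rw [variationUpTo, variationUpTo, this]

/-- The measure on the line whose distribution function is the variation of `F` along `D`. -/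
noncomputable def variationMeasure (hBV : BoundedVariationOn F D) : Measure ℝ :=
  (monotone_variationUpTo hBV).stieltjesFunction.measure

instance isFiniteMeasure_variationMeasure (hBV : BoundedVariationOn F D) :
    IsFiniteMeasure (variationMeasure hBV) := by
  refine StieltjesFunction.isFiniteMeasure_of_forall_abs_le _ (C := (eVariationOn F D).toReal) ?_
  intro x
  have hm := monotone_variationUpTo hBV
  rw [Monotone.stieltjesFunction_eq, abs_le]
  have h1 := hm.le_rightLim (le_refl x)
  have h2 := hm.rightLim_le (lt_add_one x)
  have h3 := abs_le.1 (abs_variationUpTo_le hBV x)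
  have h4 := abs_le.1 (abs_variationUpTo_le hBV (x + 1))
  constructor <;> linarith

/-- The Stieltjes function consists of right limits, so the value at `x` dominates that at `s` only
for `s < x`. -/
theorem ofReal_sub_le_variationMeasure (hBV : BoundedVariationOn F D) {s x y : ℝ} (hsx : s < x) :
    ENNReal.ofReal (variationUpTo F D y - variationUpTo F D x)
      ≤ variationMeasure hBV (Ioc s y) := by
  have hm := monotone_variationUpTo hBV
  rw [variationMeasure, StieltjesFunction.measure_Ioc, Monotone.stieltjesFunction_eq,
    Monotone.stieltjesFunction_eq]
  exact ENNReal.ofReal_le_ofReal (sub_le_sub (hm.le_rightLim le_rfl) (hm.rightLim_le hsx))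

theorem ofReal_abs_sub_le_variationMeasure_of_lt (hBV : BoundedVariationOn F D) {s x y : ℝ}
    (hsx : s < x) (hx : x ∈ D) (hy : y ∈ D) (hxy : x ≤ y) :
    ENNReal.ofReal |F y - F x| ≤ variationMeasure hBV (Ioc s y) :=
  (ENNReal.ofReal_le_ofReal (abs_sub_le_variationUpTo hBV hx hy hxy)).trans
    (ofReal_sub_le_variationMeasure hBV hsx)

theorem variationMeasure_compl (hD : IsClosed D) (hBV : BoundedVariationOn F D) :
    variationMeasure hBV Dᶜ = 0 := by
  refine measure_null_of_locally_null _ fun x hx => ?_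
  obtain ⟨l, u, ⟨hlx, hxu⟩, hsub⟩ := mem_nhds_iff_exists_Ioo_subset.1 (hD.isOpen_compl.mem_nhds hx)
  obtain ⟨l', hll', hl'x⟩ := exists_between hlx
  obtain ⟨u', hxu', hu'u⟩ := exists_between hxu
  -- The right limit at `u'` is bounded by the value at `w`, a later point of the same interval off
  -- `D`.
  obtain ⟨w, hu'w, hwu⟩ := exists_between hu'u
  refine ⟨Ioc l' u', mem_nhdsWithin_of_mem_nhds (Ioc_mem_nhds hl'x hxu'), ?_⟩
  have hm := monotone_variationUpTo hBV
  rw [variationMeasure, StieltjesFunction.measure_Ioc, Monotone.stieltjesFunction_eq,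
    Monotone.stieltjesFunction_eq, ENNReal.ofReal_eq_zero]
  have h1 := hm.le_rightLim (le_refl l')
  have h2 := hm.rightLim_le hu'w
  have h3 : variationUpTo F D l' = variationUpTo F D w := by
    refine variationUpTo_eq (by linarith) ?_
    rw [eq_empty_iff_forall_notMem]
    rintro t ⟨htD, ht1, ht2⟩
    exact hsub ⟨hll'.trans ht1, ht2.trans_lt hwu⟩ htD
  linarith

/-- To start at `c` itself: if `c` is right-isolated in `D`, the variation is constant just after
`c`; otherwise let `x → c` from the right within `D`, using continuity. -/
theorem ofReal_abs_sub_le_variationMeasure_Ioc (hF : ContinuousOn F D)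
    (hBV : BoundedVariationOn F D) {c d : ℝ} (hc : c ∈ D) (hd : d ∈ D) (hcd : c < d) :
    ENNReal.ofReal |F d - F c| ≤ variationMeasure hBV (Ioc c d) := by
  rcases eq_or_neBot (𝓝[D ∩ Ioi c] c) with h | h
  · obtain ⟨t, hct, ht⟩ := exists_gt_inter_Ioo_eq_empty h
    obtain ⟨s, hcs, hst⟩ := exists_between (lt_min hct hcd)
    rw [lt_min_iff] at hst
    have e : variationUpTo F D c = variationUpTo F D s := by
      refine variationUpTo_eq hcs.le ?_
      rw [eq_empty_iff_forall_notMem]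
      rintro w ⟨hwD, hw⟩
      exact ht.subset ⟨hwD, hw.1, hw.2.trans_lt hst.1⟩
    refine (ENNReal.ofReal_le_ofReal (abs_sub_le_variationUpTo hBV hc hd hcd.le)).trans ?_
    rw [e]
    exact ofReal_sub_le_variationMeasure hBV hcs
  · have lim : Tendsto (fun x => ENNReal.ofReal |F d - F x|) (𝓝[D ∩ Ioi c] c)
        (𝓝 (ENNReal.ofReal |F d - F c|)) :=
      ENNReal.tendsto_ofReal ((tendsto_const_nhds.sub
        ((hF c hc).mono_left (nhdsWithin_mono _ inter_subset_left))).abs)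
    refine le_of_tendsto lim ?_
    filter_upwards [self_mem_nhdsWithin, mem_nhdsWithin_of_mem_nhds (Iio_mem_nhds hcd)]
      with x hx hxd
    exact ofReal_abs_sub_le_variationMeasure_of_lt hBV hx.2 hx.1 hd (le_of_lt hxd)

/-- Approaching `d` from the left within `D` avoids any mass at `d`. -/
theorem ofReal_abs_sub_le_variationMeasure_Ioo (hF : ContinuousOn F D)
    (hBV : BoundedVariationOn F D) {c d : ℝ} (hc : c ∈ D) (hd : d ∈ D) (hcd : c < d)
    (hne : (𝓝[D ∩ Iio d] d).NeBot) :
    ENNReal.ofReal |F d - F c| ≤ variationMeasure hBV (Ioo c d) := by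
  have lim : Tendsto (fun x => ENNReal.ofReal |F x - F c|) (𝓝[D ∩ Iio d] d)
      (𝓝 (ENNReal.ofReal |F d - F c|)) :=
    ENNReal.tendsto_ofReal ((((hF d hd).mono_left
      (nhdsWithin_mono _ inter_subset_left)).sub tendsto_const_nhds).abs)
  refine le_of_tendsto lim ?_
  filter_upwards [self_mem_nhdsWithin, mem_nhdsWithin_of_mem_nhds (Ioi_mem_nhds hcd)]
    with x hx hcx
  exact (ofReal_abs_sub_le_variationMeasure_Ioc hF hBV hc hx.1 hcx).trans
    (measure_mono fun t ht => ⟨ht.1, ht.2.trans_lt hx.2⟩)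

/-- The increment of `F` between two points of `D` is controlled by the increment between the
extreme points of `C` in between, and the variation carried by the complement of `C` and by the
right ends of short gaps. -/
theorem ofReal_abs_sub_le_add_variationMeasure (hF : ContinuousOn F D) (hD : IsClosed D)
    (hBV : BoundedVariationOn F D) {C : Set ℝ} (hC : IsClosed C) (hCD : C ⊆ D) {c d η : ℝ}
    (hc : c ∈ D) (hd : d ∈ D) (hcd : c < d) (hη : d - c < η) (hne : (C ∩ Icc c d).Nonempty) :
    ∃ c' ∈ C, ∃ d' ∈ C, c ≤ c' ∧ c' ≤ d' ∧ d' ≤ d ∧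
      ENNReal.ofReal |F d - F c| ≤ ENNReal.ofReal |F d' - F c'|
        + variationMeasure hBV (Ioc c d ∩ Cᶜ)
        + variationMeasure hBV (Ioc c d ∩ rightEndsOfShortGaps D η) := by
  set μ := variationMeasure hBV
  set P := rightEndsOfShortGaps D η
  have hcomp : IsCompact (C ∩ Icc c d) := isCompact_Icc.inter_left hC
  obtain ⟨c', ⟨hc'C, hcc', hc'd⟩, hmin⟩ := hcomp.exists_isLeast hne
  obtain ⟨d', ⟨hd'C, hcd', hd'd⟩, hmax⟩ := hcomp.exists_isGreatest hne
  have hc'd' : c' ≤ d' := hmax ⟨hc'C, hcc', hc'd⟩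
  have left : ENNReal.ofReal |F c' - F c| ≤ μ (Ioo c c') + μ (Ioc c d ∩ P) := by
    rcases hcc'.eq_or_lt with rfl | hlt
    · simp
    -- The point `c'` lies in `C`, so its mass is not counted off `C`. It is needed only if `c'` is
    -- left-isolated in `D`, and then `c'` ends a short gap. On the right, `Ioc d' d` already misses
    -- `d'`.
    rcases eq_or_neBot (𝓝[D ∩ Iio c'] c') with h | h
    · have hP : c' ∈ P := mem_rightEndsOfShortGaps hD hc (hCD hc'C) hlt (by linarith) h
      refine (ofReal_abs_sub_le_variationMeasure_Ioc hF hBV hc (hCD hc'C) hlt).trans ?_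
      refine (measure_mono ?_).trans (measure_union_le _ _)
      rintro t ⟨ht1, ht2⟩
      rcases ht2.eq_or_lt with rfl | ht2
      · exact Or.inr ⟨⟨ht1, hc'd⟩, hP⟩
      · exact Or.inl ⟨ht1, ht2⟩
    · exact (ofReal_abs_sub_le_variationMeasure_Ioo hF hBV hc (hCD hc'C) hlt h).trans le_self_add
  have right : ENNReal.ofReal |F d - F d'| ≤ μ (Ioc d' d) := by
    rcases hd'd.eq_or_lt with rfl | hlt
    · simp
    · exact ofReal_abs_sub_le_variationMeasure_Ioc hF hBV (hCD hd'C) hd hlt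
  have outside : μ (Ioo c c') + μ (Ioc d' d) ≤ μ (Ioc c d ∩ Cᶜ) := by
    rw [← measure_union (by
      rw [Set.disjoint_left]
      rintro t ht1 ht2
      linarith [ht1.2, ht2.1]) measurableSet_Ioc]
    refine measure_mono ?_
    rintro t (ht | ht)
    · exact ⟨⟨ht.1, by linarith [ht.2]⟩, fun htC =>
        (hmin ⟨htC, ht.1.le, by linarith [ht.2]⟩).not_gt ht.2⟩
    · exact ⟨⟨by linarith [ht.1], ht.2⟩, fun htC =>
        (hmax ⟨htC, by linarith [ht.1], ht.2⟩).not_gt ht.1⟩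
  refine ⟨c', hc'C, d', hd'C, hcc', hc'd', hd'd, ?_⟩
  have tri : |F d - F c| ≤ |F d' - F c'| + |F c' - F c| + |F d - F d'| := by
    have e : F d - F c = (F d' - F c') + (F c' - F c) + (F d - F d') := by ring
    rw [e]
    exact abs_add_three _ _ _
  calc ENNReal.ofReal |F d - F c|
      ≤ ENNReal.ofReal |F d' - F c'| + ENNReal.ofReal |F c' - F c|
          + ENNReal.ofReal |F d - F d'| := by
        rw [← ENNReal.ofReal_add (abs_nonneg _) (abs_nonneg _),
          ← ENNReal.ofReal_add (by positivity) (abs_nonneg _)]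
        exact ENNReal.ofReal_le_ofReal tri
    _ ≤ ENNReal.ofReal |F d' - F c'| + (μ (Ioo c c') + μ (Ioc c d ∩ P)) + μ (Ioc d' d) := by
        gcongr
    _ = ENNReal.ofReal |F d' - F c'| + (μ (Ioo c c') + μ (Ioc d' d)) + μ (Ioc c d ∩ P) := by
        ring
    _ ≤ _ := by gcongr

theorem ofReal_abs_sub_le_of_inter_eq_empty (hF : ContinuousOn F D)
    (hBV : BoundedVariationOn F D) {C : Set ℝ} {c d : ℝ}
    (hc : c ∈ D) (hd : d ∈ D) (hcd : c < d) (he : C ∩ Icc c d = ∅) :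
    ENNReal.ofReal |F d - F c| ≤ variationMeasure hBV (Ioc c d ∩ Cᶜ) := by
  refine (ofReal_abs_sub_le_variationMeasure_Ioc hF hBV hc hd hcd).trans (measure_mono ?_)
  exact fun t ht => ⟨ht, fun htC => he.subset ⟨htC, ht.1.le, ht.2⟩⟩

theorem sum_measure_Ioc_inter_le (μ : Measure ℝ) (X : Set ℝ) {q : ℕ}
    {c d : Fin q → ℝ}
    (hdisj : Pairwise fun i j => Disjoint (Ioo (c i) (d i)) (Ioo (c j) (d j))) :
    ∑ i, μ (Ioc (c i) (d i) ∩ X) ≤ μ X := by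
  have := sum_measure_le_measure_univ (μ := μ.restrict X) (s := Finset.univ)
    (t := fun i => Ioc (c i) (d i)) (fun i _ => measurableSet_Ioc.nullMeasurableSet)
    (fun i _ j _ hij => by
      refine Disjoint.aedisjoint ?_
      have hd : Disjoint (Ioo (c i) (d i)) (Ioo (c j) (d j)) := hdisj hij
      rw [Ioo_disjoint_Ioo] at hd
      rw [Ioc_disjoint_Ioc]
      exact hd)
  simpa [Measure.restrict_apply, measurableSet_Ioc] using this

/-- A continuous function of bounded variation on a closed set `D` is absolutely continuous on `D`
if, for every `ε > 0`, the set `D` is exhausted by closed sets on each of which short families of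
intervals carry a variation of at most `ε`. -/
theorem isACOn_of_exhaustion (hF : ContinuousOn F D) (hD : IsClosed D)
    (hBV : BoundedVariationOn F D)
    (hex : ∀ ε > 0, ∃ C : ℕ → Set ℝ, Monotone C ∧ (∀ n, IsClosed (C n)) ∧ (∀ n, C n ⊆ D) ∧
      D ⊆ ⋃ n, C n ∧ ∀ n, ∃ η > 0, HasSmallVariationOn F (C n) η ε) : IsACOn F D := by
  classical
  intro ε hε
  set μ := variationMeasure hBV with hμ
  have hε4 : 0 < ENNReal.ofReal (ε / 4) := by simpa using hε
  obtain ⟨C, hCmono, hCcl, hCD, hDC, hCvar⟩ := hex (ε / 4) (by linarith)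
  -- The sets `(C n)ᶜ` decrease to a subset of `Dᶜ`, which is null for the finite measure `μ`.
  obtain ⟨n, hn⟩ : ∃ n, μ (C n)ᶜ < ENNReal.ofReal (ε / 4) := by
    have lim := tendsto_measure_iInter_atTop (μ := μ) (s := fun n => (C n)ᶜ)
      (fun n => (hCcl n).measurableSet.compl.nullMeasurableSet)
      (fun k n hkn => compl_subset_compl.2 (hCmono hkn)) ⟨0, measure_ne_top _ _⟩
    have h0 : μ (⋂ n, (C n)ᶜ) = 0 := by
      rw [← compl_iUnion]
      exact measure_mono_null (compl_subset_compl.2 hDC) (variationMeasure_compl hD hBV)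
    rw [h0] at lim
    exact (lim.eventually_lt_const hε4).exists
  obtain ⟨k, hk⟩ : ∃ k : ℕ, μ (rightEndsOfShortGaps D (1 / ((k : ℝ) + 1)))
      < ENNReal.ofReal (ε / 4) := by
    have lim := tendsto_measure_iInter_atTop (μ := μ)
      (s := fun n : ℕ => rightEndsOfShortGaps D (1 / ((n : ℝ) + 1)))
      (fun n => countable_rightEndsOfShortGaps.measurableSet.nullMeasurableSet)
      antitone_rightEndsOfShortGaps ⟨0, measure_ne_top _ _⟩
    rw [iInter_rightEndsOfShortGaps, measure_empty] at lim
    exact (lim.eventually_lt_const hε4).exists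
  set P := rightEndsOfShortGaps D (1 / ((k : ℝ) + 1)) with hP
  obtain ⟨η, hη, hvar⟩ := hCvar n
  refine ⟨min η (1 / ((k : ℝ) + 1)), lt_min hη (by positivity), fun q c d hcd hdisj hsum => ?_⟩
  rw [lt_min_iff] at hsum
  have hlen : ∀ i, d i - c i < 1 / ((k : ℝ) + 1) := fun i =>
    (Finset.single_le_sum (f := fun i => d i - c i)
      (fun j _ => (sub_pos.2 (hcd j).2.2).le) (Finset.mem_univ i)).trans_lt hsum.2
  have hdec : ∀ i, (C n ∩ Icc (c i) (d i)).Nonempty → ∃ c' ∈ C n, ∃ d' ∈ C n,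
      c i ≤ c' ∧ c' ≤ d' ∧ d' ≤ d i ∧
      ENNReal.ofReal |F (d i) - F (c i)| ≤ ENNReal.ofReal |F d' - F c'|
        + μ (Ioc (c i) (d i) ∩ (C n)ᶜ) + μ (Ioc (c i) (d i) ∩ P) := fun i hi =>
    ofReal_abs_sub_le_add_variationMeasure hF hD hBV (hCcl n) (hCD n) (hcd i).1 (hcd i).2.1
      (hcd i).2.2 (hlen i) hi
  choose! c' hc' d' hd' h1 h2 h3 h4 using hdec
  set s := Finset.univ.filter fun i => (C n ∩ Icc (c i) (d i)).Nonempty with hs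
  have hmem : ∀ i ∈ s, (C n ∩ Icc (c i) (d i)).Nonempty := fun i hi => (Finset.mem_filter.1 hi).2
  have inner : ∑ i ∈ s, |F (d' i) - F (c' i)| ≤ ε / 4 := by
    refine hvar.sum_le s (fun i hi => ⟨hc' i (hmem i hi), hd' i (hmem i hi), h2 i (hmem i hi)⟩)
      (fun i hi j hj hij => ?_) (lt_of_le_of_lt ?_ hsum.1)
    · exact (hdisj hij).mono (Ioo_subset_Ioo (h1 i (hmem i hi)) (h3 i (hmem i hi)))
        (Ioo_subset_Ioo (h1 j (hmem j hj)) (h3 j (hmem j hj)))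
    · calc ∑ i ∈ s, (d' i - c' i) ≤ ∑ i ∈ s, (d i - c i) :=
            Finset.sum_le_sum fun i hi => sub_le_sub (h3 i (hmem i hi)) (h1 i (hmem i hi))
        _ ≤ ∑ i, (d i - c i) :=
            Finset.sum_le_sum_of_subset_of_nonneg (Finset.subset_univ s)
              fun i _ _ => (sub_pos.2 (hcd i).2.2).le
  have bound : ∀ i, ENNReal.ofReal |F (d i) - F (c i)|
      ≤ (if i ∈ s then ENNReal.ofReal |F (d' i) - F (c' i)| else 0)
        + μ (Ioc (c i) (d i) ∩ (C n)ᶜ) + μ (Ioc (c i) (d i) ∩ P) := by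
    intro i
    by_cases hi : i ∈ s
    · rw [if_pos hi]
      exact h4 i (hmem i hi)
    · rw [if_neg hi, zero_add]
      have he : C n ∩ Icc (c i) (d i) = ∅ := by
        rw [← not_nonempty_iff_eq_empty]
        exact fun hne => hi (Finset.mem_filter.2 ⟨Finset.mem_univ i, hne⟩)
      exact (ofReal_abs_sub_le_of_inter_eq_empty hF hBV (hcd i).1 (hcd i).2.1 (hcd i).2.2
        he).trans le_self_add
  have total : ENNReal.ofReal (∑ i, |F (d i) - F (c i)|) ≤ ENNReal.ofReal (3 * (ε / 4)) := by
    calc ENNReal.ofReal (∑ i, |F (d i) - F (c i)|)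
        = ∑ i, ENNReal.ofReal |F (d i) - F (c i)| :=
          ENNReal.ofReal_sum_of_nonneg fun i _ => abs_nonneg _
      _ ≤ ∑ i, ((if i ∈ s then ENNReal.ofReal |F (d' i) - F (c' i)| else 0)
          + μ (Ioc (c i) (d i) ∩ (C n)ᶜ) + μ (Ioc (c i) (d i) ∩ P)) :=
          Finset.sum_le_sum fun i _ => bound i
      _ = ENNReal.ofReal (∑ i ∈ s, |F (d' i) - F (c' i)|)
          + ∑ i, μ (Ioc (c i) (d i) ∩ (C n)ᶜ) + ∑ i, μ (Ioc (c i) (d i) ∩ P) := by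
          rw [Finset.sum_add_distrib, Finset.sum_add_distrib, Finset.sum_ite_mem,
            Finset.univ_inter, ENNReal.ofReal_sum_of_nonneg fun i _ => abs_nonneg _]
      _ ≤ ENNReal.ofReal (ε / 4) + ENNReal.ofReal (ε / 4) + ENNReal.ofReal (ε / 4) := by
          gcongr
          · exact (sum_measure_Ioc_inter_le μ _ hdisj).trans hn.le
          · exact (sum_measure_Ioc_inter_le μ _ hdisj).trans hk.le
      _ = ENNReal.ofReal (3 * (ε / 4)) := by
          rw [← ENNReal.ofReal_add (by positivity) (by positivity),
            ← ENNReal.ofReal_add (by positivity) (by positivity)]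
          ring_nf
  have := (ENNReal.ofReal_le_ofReal_iff (by positivity)).1 total
  linarith

end VariationMeasure

/-! ### Decomposition of the interval -/

section Assembly

variable {a b : ℝ} {f F : ℝ → ℝ}

theorem monotone_gaugeLevel (δ : ℝ → ℝ) :
    Monotone fun n : ℕ => gaugeLevel a b f δ (1 / ((n : ℝ) + 1)) ((n : ℝ) + 1) := by
  rintro k n hkn x ⟨hx, hδ, hf⟩
  have : (k : ℝ) ≤ n := by exact_mod_cast hkn
  refine ⟨hx, le_trans ?_ hδ, hf.trans (by linarith)⟩
  exact one_div_le_one_div_of_le (by positivity) (by linarith)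

theorem Icc_subset_iUnion_gaugeLevel {δ : ℝ → ℝ} (hδ : ∀ t ∈ Icc a b, 0 < δ t) :
    Icc a b ⊆ ⋃ n : ℕ, gaugeLevel a b f δ (1 / ((n : ℝ) + 1)) ((n : ℝ) + 1) := by
  intro x hx
  obtain ⟨n, hn⟩ := exists_nat_one_div_lt (hδ x hx)
  obtain ⟨k, hk⟩ := exists_nat_ge |f x|
  refine mem_iUnion.2 ⟨max n k, hx, le_trans ?_ hn.le, hk.trans ?_⟩
  · have : (n : ℝ) ≤ (max n k : ℕ) := by exact_mod_cast le_max_left n k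
    exact one_div_le_one_div_of_le (by positivity) (by linarith)
  · have : (k : ℝ) ≤ (max n k : ℕ) := by exact_mod_cast le_max_right n k
    linarith

/-- The fixed gauge `δ` gives continuity and bounded variation on `D`; the exhaustion comes from a
new gauge for each `θ`, with control `θ / 3` since the variation bound is three times the control.
-/
theorem isACOn_of_subset_closure_gaugeLevel (H : ∀ ε > 0, ∃ δ, ControlsMeanDev a b f F δ ε)
    (hF : IntegrableOn F (Icc a b)) {δ : ℝ → ℝ} {ε h m : ℝ} (G : ControlsMeanDev a b f F δ ε)
    (hh : 0 < h) (hm : 0 < m) {D : Set ℝ} (hD : IsClosed D)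
    (hDsub : D ⊆ closure (gaugeLevel a b f δ h m)) {u v : ℝ} (hDuv : D ⊆ Icc u v)
    (huv : v - u < min h (ε / m)) : IsACOn F D := by
  have hcont : ContinuousOn F D := (continuousOn_closure_of_tendsto fun x hx =>
    tendsto_nhdsWithin_gaugeLevel H hF G hh (closure_gaugeLevel_subset hx)).mono hDsub
  have hBV : BoundedVariationOn F D :=
    ((G.hasSmallVariationOn H hF hh hm).mono hDsub).boundedVariationOn hDuv huv
  refine isACOn_of_exhaustion hcont hD hBV fun θ hθ => ?_
  obtain ⟨δ', G'⟩ := H (θ / 3) (by linarith)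
  refine ⟨fun n => closure (gaugeLevel a b f δ' (1 / ((n : ℝ) + 1)) ((n : ℝ) + 1)) ∩ D,
    fun k n hkn => inter_subset_inter_left _ (closure_mono (monotone_gaugeLevel δ' hkn)),
    fun n => isClosed_closure.inter hD, fun n => inter_subset_right, fun x hx => ?_, fun n => ?_⟩
  · obtain ⟨n, hn⟩ := mem_iUnion.1 (Icc_subset_iUnion_gaugeLevel (f := f) G'.1
      (closure_gaugeLevel_subset (hDsub hx)))
    exact mem_iUnion.2 ⟨n, subset_closure hn, hx⟩
  · have hn : (0 : ℝ) < (n : ℝ) + 1 := by positivity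
    have := (G'.hasSmallVariationOn H hF (one_div_pos.2 hn) hn).mono
      (inter_subset_left (t := D))
    rw [show 3 * (θ / 3) = θ by ring] at this
    exact ⟨_, lt_min (one_div_pos.2 hn) (by positivity), this⟩

theorem exists_mem_Icc_add_mul {a x w : ℝ} (hx : a ≤ x) (hw : 0 < w) :
    ∃ j : ℕ, x ∈ Icc (a + j * w) (a + (j + 1) * w) := by
  refine ⟨⌊(x - a) / w⌋₊, ?_, ?_⟩
  · have := Nat.floor_le (div_nonneg (sub_nonneg.2 hx) hw.le)
    rw [le_div_iff₀ hw] at this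
    linarith
  · have := (Nat.lt_floor_add_one ((x - a) / w)).le
    rw [div_le_iff₀ hw] at this
    linarith

theorem isClosedACG_of_controlsMeanDev (H : ∀ ε > 0, ∃ δ, ControlsMeanDev a b f F δ ε)
    (hF : IntegrableOn F (Icc a b)) : IsClosedACG a b F := by
  obtain ⟨δ, G⟩ := H 1 one_pos
  let m : ℕ → ℝ := fun n => (n : ℝ) + 1
  have hm : ∀ n, 0 < m n := fun n => by positivity
  -- With `ε = 1` and `h = 1 / m` the admissible length `min h (ε / m)` is `1 / m`; half of it gives
  -- the strict inequality.
  let D : ℕ × ℕ → Set ℝ := fun p => closure (gaugeLevel a b f δ (1 / m p.1) (m p.1)) ∩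
    Icc (a + p.2 * (1 / (2 * m p.1))) (a + (p.2 + 1) * (1 / (2 * m p.1)))
  have hcl : ∀ p, IsClosed (D p) := fun p => isClosed_closure.inter isClosed_Icc
  refine ⟨fun k => D k.unpair, fun k => hcl _, ?_, fun k => ?_⟩
  · refine Subset.antisymm
      (iUnion_subset fun k => inter_subset_left.trans closure_gaugeLevel_subset) fun x hx => ?_
    obtain ⟨n, hn⟩ := mem_iUnion.1 (Icc_subset_iUnion_gaugeLevel (f := f) G.1 hx)
    obtain ⟨j, hj⟩ := exists_mem_Icc_add_mul hx.1
      (one_div_pos.2 (mul_pos two_pos (hm n)))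
    refine mem_iUnion.2 ⟨Nat.pair n j, ?_⟩
    rw [Nat.unpair_pair]
    exact ⟨subset_closure hn, hj⟩
  · refine isACOn_of_subset_closure_gaugeLevel H hF G (one_div_pos.2 (hm _)) (hm _) (hcl _)
      inter_subset_left inter_subset_right ?_
    have h0 := one_div_pos.2 (hm k.unpair.1)
    have e : 1 / (2 * m k.unpair.1) = 1 / m k.unpair.1 / 2 := by
      have := (hm k.unpair.1).ne'
      field_simp
    rw [min_self, e]
    linarith

end Assembly

theorem mainTheorem3 (r : ℝ) (hr : 1 ≤ r) (a b : ℝ) (hab : a < b) (f F : ℝ → ℝ)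
    (hF : IsIndefiniteHKr r a b f F) : IsClosedACG a b F :=
  isClosedACG_of_controlsMeanDev (fun _ hε => hF.1.exists_controlsMeanDev hr hε)
    (hF.1.integrableOn hr)
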